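/- Let $\mathcal H$ be a $d$-dimensional complex Hilbert space and let $k\ge 2$ and $n\ge 0$ be integers. For $N\in\mathbb N$ let $\mathrm{Sym}^N(\mathcal H)\subseteq\mathcal H^{\otimes N}$ be the subspace of vectors fixed by every permutation of the $N$ tensor factors. For a vector $\nu\in\mathcal H$ let $\mathrm{Sym}^{k+n}(\mathcal H,\nu^{\otimes n})$ be the subspace of those vectors of $\mathrm{Sym}^{k+n}(\mathcal H)$ that lie in the span of all vectors in $\pi\bigl(\mathcal H^{\otimes k}\otimes \mathrm{span}\{\nu\}^{\otimes n}\bigr)$, where $\pi$ ranges over the permutations of the $k+n$ tensor factors. Then there exist a finite set $\mathcal V$ of unit vectors of $\mathcal H$, a Hilbert space $\mathcal H'$ with an orthonormal basis $\{f_\nu\}_{\nu\in\mathcal V}$, and a linear isometry $U:\mathcal H^{\otimes k}\to\mathcal H'$ such that the following holds. For every unit vector $\Phi\in\mathrm{Sym}^{2k+n}(\mathcal H)$ there exists a unit vector $\hat\Phi\in\mathcal H'\otimes\mathrm{Sym}^{k+n}(\mathcal H)$ of the form $$\hat\Phi=\frac{1}{\sqrt{|\mathcal V|}}\sum_{\nu\in\mathcal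 V} f_\nu\otimes\hat\Phi_\nu,\qquad \hat\Phi_\nu\in\mathrm{Sym}^{k+n}(\mathcal H,\nu^{\otimes n}),$$ such that $\langle\hat\Phi,\,(U\otimes 1^{\otimes (k+n)})\Phi\rangle$ is real and $$\bigl\langle\hat\Phi,\,(U\otimes 1^{\otimes (k+n)})\Phi\bigr\rangle>1-k^d\,e^{-\frac{k(k+1)}{2k+n}} .$$ Here $\mathcal H^{\otimes(2k+n)}$ is identified with $\mathcal H^{\otimes k}\otimes\mathcal H^{\otimes(k+n)}$, so that $U$ acts on the first $k$ factors. -/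

import Mathlib

open scoped TensorProduct InnerProductSpace

namespace DeFinetti

/-- The `N`-fold tensor power `H^{⊗N}` of a complex vector space. It is a copy of Mathlib's
algebraic tensor power, so that it can carry the Hilbert space norm below instead of the
projective seminorm. -/
def TensorPow (N : ℕ) (H : Type*) [AddCommGroup H] [Module ℂ H] : Type _ := ⨂[ℂ]^N H

section Algebra

variable {H : Type*} [AddCommGroup H] [Module ℂ H]

noncomputable instance (N : ℕ) : AddCommGroup (TensorPow N H) :=
  inferInstanceAs (AddCommGroup (⨂[ℂ] _ : Fin N, H))

noncomputable instance (N : ℕ) : Module ℂ (TensorPow N H) :=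
  inferInstanceAs (Module ℂ (⨂[ℂ] _ : Fin N, H))

/-- The identity map from `H^{⊗N}` to Mathlib's algebraic tensor power. -/
noncomputable def toAlg (N : ℕ) : TensorPow N H ≃ₗ[ℂ] ⨂[ℂ]^N H := LinearEquiv.refl ℂ _

/-- The product vector `x₁ ⊗ ⋯ ⊗ x_N`. -/
noncomputable def prodVec {N : ℕ} (x : Fin N → H) : TensorPow N H :=
  (toAlg N).symm (PiTensorProduct.tprod ℂ x)

/-- The action of a permutation `π` of the tensor factors on `H^{⊗N}`. -/
noncomputable def permute {N : ℕ} (π : Equiv.Perm (Fin N)) : TensorPow N H ≃ₗ[ℂ] TensorPow N H :=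
  (toAlg N).trans ((PiTensorProduct.reindex ℂ (fun _ => H) π).trans (toAlg N).symm)

theorem permute_prodVec {N : ℕ} (π : Equiv.Perm (Fin N)) (x : Fin N → H) :
    permute π (prodVec x) = prodVec (fun i => x (π.symm i)) := by
  simp [permute, prodVec]

/-- The identification of `H^{⊗N}` with `H^{⊗a} ⊗ H^{⊗b}`, where `N = a + b`: the first `a`
factors are separated from the last `b` factors. -/
noncomputable def split {N a b : ℕ} (h : a + b = N) :
    TensorPow N H ≃ₗ[ℂ] TensorPow a H ⊗[ℂ] TensorPow b H :=
  (toAlg N).trans (((TensorPower.cast ℂ H h).symm.trans TensorPower.mulEquiv.symm).trans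
    (TensorProduct.congr (toAlg a) (toAlg b)).symm)

theorem split_symm_prodVec {N a b : ℕ} (h : a + b = N) (x : Fin a → H) (y : Fin b → H) :
    (split h).symm (prodVec x ⊗ₜ[ℂ] prodVec y) = prodVec (fun i => Fin.append x y (Fin.cast h.symm i)) := by
  subst h
  have := TensorPower.tprod_mul_tprod ℂ x y
  rw [TensorPower.gMul_def] at this
  simp [split, prodVec, this]

/-- The symmetric subspace `Sym^N(H)` of `H^{⊗N}`: all vectors fixed by every permutation. -/
noncomputable def symSubspace (N : ℕ) (H : Type*) [AddCommGroup H] [Module ℂ H] :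
    Submodule ℂ (TensorPow N H) where
  carrier := {Φ | ∀ π : Equiv.Perm (Fin N), permute π Φ = Φ}
  add_mem' hx hy π := by rw [map_add, hx π, hy π]
  zero_mem' π := map_zero _
  smul_mem' c x hx π := by rw [map_smul, hx π]

/-- The subspace of `H^{⊗(k+n)}` spanned by the vectors in `π(H^{⊗k} ⊗ K^{⊗n})`, where `π` ranges
over all permutations of the `k + n` factors. -/
noncomputable def restrictedSupport (k n : ℕ) (K : Submodule ℂ H) :
    Submodule ℂ (TensorPow (k + n) H) :=
  Submodule.span ℂ {Ψ | ∃ (π : Equiv.Perm (Fin (k + n))) (x : Fin k → H) (y : Fin n → H),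
    (∀ j, y j ∈ K) ∧ Ψ = permute π (prodVec (Fin.append x y))}

/-- The restricted symmetric subspace `Sym^{k+n}(H, K^{⊗n})`: the symmetric vectors that are
superpositions of vectors in `π(H^{⊗k} ⊗ K^{⊗n})`. -/
noncomputable def restrictedSym (k n : ℕ) (K : Submodule ℂ H) :
    Submodule ℂ (TensorPow (k + n) H) :=
  symSubspace (k + n) H ⊓ restrictedSupport k n K

end Algebra

section Hilbert

variable {H : Type*} [NormedAddCommGroup H] [InnerProductSpace ℂ H] [FiniteDimensional ℂ H]

/-- The coordinates of a vector of `H^{⊗N}` in the product basis `e_{j₁} ⊗ ⋯ ⊗ e_{j_N}` formed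
from an orthonormal basis `e` of `H`. -/
noncomputable def coords (N : ℕ) :
    TensorPow N H ≃ₗ[ℂ] EuclideanSpace ℂ (Fin N → Fin (Module.finrank ℂ H)) :=
  (toAlg N).trans
    ((Basis.piTensorProduct fun _ : Fin N => (stdOrthonormalBasis ℂ H).toBasis).equivFun.trans
      (WithLp.linearEquiv 2 ℂ ((Fin N → Fin (Module.finrank ℂ H)) → ℂ)).symm)

theorem coords_prodVec {N : ℕ} (x : Fin N → H) (p : Fin N → Fin (Module.finrank ℂ H)) :
    coords N (prodVec x) p = ∏ i, ⟪stdOrthonormalBasis ℂ H (p i), x i⟫_ℂ := by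
  have h : coords N (prodVec x) p = (Basis.piTensorProduct
      fun _ : Fin N => (stdOrthonormalBasis ℂ H).toBasis).repr (PiTensorProduct.tprod ℂ x) p := rfl
  rw [h, Basis.piTensorProduct_repr_tprod_apply]
  simp [OrthonormalBasis.repr_apply_apply]

/-- The Hilbert space structure of `H^{⊗N}`, in which product vectors of an orthonormal basis of
`H` are orthonormal. By `inner_prodVec` it does not depend on the basis. -/
noncomputable instance (N : ℕ) : NormedAddCommGroup (TensorPow N H) :=
  NormedAddCommGroup.induced _ _ (coords (H := H) N).toLinearMap (coords N).injective

noncomputable instance (N : ℕ) : InnerProductSpace ℂ (TensorPow N H) :=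
  InnerProductSpace.induced (coords (H := H) N).toLinearMap

theorem inner_prodVec {N : ℕ} (x y : Fin N → H) :
    ⟪prodVec x, prodVec y⟫_ℂ = ∏ i, ⟪x i, y i⟫_ℂ := by
  have h : ⟪prodVec x, prodVec y⟫_ℂ = ⟪coords N (prodVec x), coords N (prodVec y)⟫_ℂ := rfl
  rw [h, PiLp.inner_apply]
  simp only [coords_prodVec, ← (stdOrthonormalBasis ℂ H).sum_inner_mul_inner (x _) (y _),
    Finset.prod_univ_sum, Fintype.piFinset_univ]
  refine Finset.sum_congr rfl fun p _ => ?_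
  simp [Finset.prod_mul_distrib, mul_comm]

end Hilbert

end DeFinetti

/-! A finite weighted family of powers `ν^{⊗k}` resolves the identity of `Sym^k(H)`: `∑ w_ν
|⟨ν^{⊗k}, x⟩|² = ‖x‖²`. So `x ↦ ∑ √w_ν ⟨ν^{⊗k}, x⟩ f_ν` is an isometry on `Sym^k(H)`; it extends to
`U` on `H^{⊗k}` once there are enough `f_ν`. Applied to a symmetric `Φ`, `U` gives `∑ √w_ν f_ν ⊗
Φ_ν`, where `Φ_ν` is the contraction of `Φ` with `ν^{⊗k}` (`exists_frame_isometry`,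
`rTensor_split_eq`).

In a product basis with `e 0 = ν`, the coordinates of `Φ_ν` are those of `Φ` on words starting with
`k` zeros. Discarding the words with more than `k` nonzero letters lands in the restricted symmetric
subspace. By permutation invariance, words with at least `k + 1` nonzero letters rarely start with
`k` zeros, so the squared error is at most `exp(-k(k+1)/(2k+n))` (`sum_prefix_le_exp`,
`exists_restrictedSym_near`). The total weight is `dim Sym^k(H) < k^d`, which yields the factor
`k^d`. Normalising the projection of `(U ⊗ 1)Φ` onto the admissible vectors gives the required
overlap (`exists_unit_overlap`).

The frame comes from convexity, without integration: minimise the Hilbert–Schmidt norm over the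
convex hull of the projections onto powers. Uniqueness of the minimiser makes it unitarily
invariant, and polarisation turns this into the frame identity. -/

namespace DeFinetti

/-! ### Powers span the symmetric subspace -/

section Powers

variable {H : Type*} [AddCommGroup H] [Module ℂ H]

/-- The vector `z ⊗ ⋯ ⊗ z`. -/
noncomputable def powVec (N : ℕ) (z : H) : TensorPow N H := prodVec fun _ => z

/-- The product vector as a multilinear map. -/
noncomputable def prodVecMultilinear (N : ℕ) (H : Type*) [AddCommGroup H] [Module ℂ H] :
    MultilinearMap ℂ (fun _ : Fin N => H) (TensorPow N H) :=
  (toAlg N).symm.toLinearMap.compMultilinearMap (PiTensorProduct.tprod ℂ)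

theorem prodVecMultilinear_apply {N : ℕ} (x : Fin N → H) :
    prodVecMultilinear N H x = prodVec x := rfl

theorem span_range_prodVec (N : ℕ) :
    Submodule.span ℂ (Set.range (prodVec : (Fin N → H) → TensorPow N H)) = ⊤ := by
  have h := PiTensorProduct.span_tprod_eq_top (R := ℂ) (s := fun _ : Fin N => H)
  have h2 := congrArg (Submodule.map (toAlg (H := H) N).symm.toLinearMap) h
  rw [Submodule.map_span, ← Set.range_comp, Submodule.map_top, LinearEquiv.range] at h2
  exact h2

theorem powVec_mem_symSubspace (N : ℕ) (z : H) : powVec N z ∈ symSubspace N H :=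
  fun π => permute_prodVec π _

theorem permute_symm_apply {N : ℕ} (π : Equiv.Perm (Fin N)) (x : Fin N → H) :
    permute π⁻¹ (prodVec x) = prodVec (x ∘ π) := by
  rw [permute_prodVec]; rfl

/-- The sum of all permutations of a product vector lies in the span of the powers, by
polarisation over signs. -/
theorem sum_permute_mem_span_powVec {N : ℕ} (x : Fin N → H) :
    ∑ π : Equiv.Perm (Fin N), prodVec (x ∘ π) ∈
      Submodule.span ℂ (Set.range (powVec (H := H) N)) := by
  classical
  have hsum (a : ℕ) : ∑ ε : ℤˣ, (((ε : ℤ) : ℂ)) ^ a = if Even a then 2 else 0 := by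
    have : (Finset.univ : Finset ℤˣ) = {1, -1} := rfl
    rw [this, Finset.sum_pair (by decide)]
    split_ifs with h
    · simp [h.neg_one_pow]; norm_num
    · simp [(Nat.not_even_iff_odd.1 h).neg_one_pow]
  have key : ∑ ε : Fin N → ℤˣ, (∏ i, ((ε i : ℤ) : ℂ)) • powVec N (∑ i, ((ε i : ℤ) : ℂ) • x i) =
      (2 : ℂ) ^ N • ∑ π : Equiv.Perm (Fin N), prodVec (x ∘ π) := by
    have hexp (ε : Fin N → ℤˣ) : powVec N (∑ i, ((ε i : ℤ) : ℂ) • x i) =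
        ∑ f : Fin N → Fin N, (∏ j, ((ε (f j) : ℤ) : ℂ)) • prodVec (x ∘ f) := by
      have := (prodVecMultilinear N H).map_sum (fun (_ : Fin N) i => ((ε i : ℤ) : ℂ) • x i)
      simp only [prodVecMultilinear_apply] at this
      rw [powVec, this]
      refine Finset.sum_congr rfl fun f _ => ?_
      exact (prodVecMultilinear N H).map_smul_univ _ _
    simp_rw [hexp, Finset.smul_sum, smul_smul]
    rw [Finset.sum_comm]
    -- Summing over signs gives `∏ i, ∑ ε, ε ^ (1 + #f⁻¹(i))`. A permutation has all exponents 2;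
    -- any other `f` misses some `i`, whose exponent 1 makes that factor 0.
    have hcoef (f : Fin N → Fin N) :
        ∑ ε : Fin N → ℤˣ, (∏ i, ((ε i : ℤ) : ℂ)) * ∏ j, ((ε (f j) : ℤ) : ℂ) =
          if Function.Bijective f then (2 : ℂ) ^ N else 0 := by
      have h1 (ε : Fin N → ℤˣ) : (∏ i, ((ε i : ℤ) : ℂ)) * ∏ j, ((ε (f j) : ℤ) : ℂ) =
          ∏ i, ((ε i : ℤ) : ℂ) ^ (1 + (Finset.univ.filter fun j => f j = i).card) := by
        have h2 := Finset.prod_fiberwise (Finset.univ : Finset (Fin N)) f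
          fun j => ((ε (f j) : ℤ) : ℂ)
        rw [← h2, ← Finset.prod_mul_distrib]
        refine Finset.prod_congr rfl fun i _ => ?_
        rw [pow_add, pow_one, ← Finset.prod_const]
        congr 1
        refine Finset.prod_congr rfl fun j hj => ?_
        rw [(Finset.mem_filter.1 hj).2]
      simp_rw [h1]
      rw [← Fintype.piFinset_univ, Finset.sum_prod_piFinset (s := Finset.univ)
        (g := fun i (e : ℤˣ) => ((e : ℤ) : ℂ) ^ (1 + (Finset.univ.filter fun j => f j = i).card))]
      simp_rw [hsum]
      split_ifs with hf
      · rw [Finset.prod_congr rfl (g := fun _ => (2 : ℂ))]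
        · simp
        · intro i _
          have : (Finset.univ.filter fun j => f j = i).card = 1 := by
            obtain ⟨j, rfl⟩ := hf.2 i
            rw [Finset.card_eq_one]
            exact ⟨j, by ext a; simp [hf.1.eq_iff]⟩
          simp [this]
      · have : ∃ i, ∀ j, f j ≠ i := by
          by_contra! h
          exact hf (Finite.injective_iff_bijective.1 (Finite.injective_iff_surjective.2 h))
        obtain ⟨i, hi⟩ := this
        refine Finset.prod_eq_zero (Finset.mem_univ i) ?_
        simp [hi]
    simp_rw [← Finset.sum_smul, hcoef, ite_smul, zero_smul]
    rw [← Finset.sum_filter]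
    refine (Finset.sum_bij (fun (π : Equiv.Perm (Fin N)) _ => (π : Fin N → Fin N)) ?_ ?_ ?_ ?_).symm
    · intro π _; exact Finset.mem_filter.2 ⟨Finset.mem_univ _, π.bijective⟩
    · intro a _ b _ h; exact DFunLike.coe_injective h
    · intro f hf; exact ⟨Equiv.ofBijective f (Finset.mem_filter.1 hf).2, Finset.mem_univ _, rfl⟩
    · intro π _; rfl
  have h2 : (2 : ℂ) ^ N ≠ 0 := pow_ne_zero _ two_ne_zero
  rw [← inv_smul_smul₀ h2 (∑ π : Equiv.Perm (Fin N), prodVec (x ∘ π)), ← key]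
  refine Submodule.smul_mem _ _ (Submodule.sum_mem _ fun ε _ => Submodule.smul_mem _ _ ?_)
  exact Submodule.subset_span ⟨_, rfl⟩

/-- The symmetric subspace is spanned by the powers `z ⊗ ⋯ ⊗ z`. -/
theorem symSubspace_eq_span_powVec (N : ℕ) :
    symSubspace N H = Submodule.span ℂ (Set.range (powVec (H := H) N)) := by
  refine le_antisymm (fun Φ hΦ => ?_) (Submodule.span_le.2 ?_)
  · have key : ∀ Ψ : TensorPow N H, ∑ π : Equiv.Perm (Fin N), permute π⁻¹ Ψ ∈
        Submodule.span ℂ (Set.range (powVec (H := H) N)) := by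
      intro Ψ
      have hΨ : Ψ ∈ Submodule.span ℂ (Set.range (prodVec : (Fin N → H) → TensorPow N H)) := by
        rw [span_range_prodVec]; trivial
      induction hΨ using Submodule.span_induction with
      | mem y hy =>
        obtain ⟨x, rfl⟩ := hy
        simp_rw [permute_symm_apply]
        exact sum_permute_mem_span_powVec x
      | zero => simp
      | add a b _ _ ha hb => simpa [Finset.sum_add_distrib] using Submodule.add_mem _ ha hb
      | smul c a _ ha => simpa [Finset.smul_sum] using Submodule.smul_mem _ c ha
    -- On a symmetric vector the sum over permutations is multiplication by `N!`.
    have h := key Φ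
    simp_rw [hΦ _] at h
    rw [Finset.sum_const, ← Nat.cast_smul_eq_nsmul ℂ] at h
    refine (Submodule.smul_mem_iff _ ?_).1 h
    exact Nat.cast_ne_zero.2 (Finset.card_ne_zero.2 Finset.univ_nonempty)
  · rintro _ ⟨z, rfl⟩
    exact powVec_mem_symSubspace N z

end Powers

/-! ### Product bases and the dimension of the symmetric subspace -/

section Bases

variable {H : Type*} [NormedAddCommGroup H] [InnerProductSpace ℂ H] [FiniteDimensional ℂ H]

instance (N : ℕ) : FiniteDimensional ℂ (TensorPow N H) :=
  (coords N).symm.finiteDimensional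

variable {ι : Type*} [Fintype ι]

/-- The product basis of `H^{⊗N}` formed from an orthonormal basis of `H`. -/
noncomputable def productBasis (N : ℕ) (e : OrthonormalBasis ι ℂ H) :
    OrthonormalBasis (Fin N → ι) ℂ (TensorPow N H) :=
  ((Basis.piTensorProduct fun _ : Fin N => e.toBasis).map (toAlg N).symm).toOrthonormalBasis (by
    classical
    rw [orthonormal_iff_ite]
    intro p q
    have h (p : Fin N → ι) : ((Basis.piTensorProduct fun _ : Fin N => e.toBasis).map
        (toAlg N).symm) p = prodVec fun i => e (p i) := by
      simp [prodVec]
    rw [h, h, inner_prodVec]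
    simp_rw [orthonormal_iff_ite.1 e.orthonormal]
    rw [Finset.prod_ite_zero]
    simp [funext_iff])

theorem productBasis_apply {N : ℕ} (e : OrthonormalBasis ι ℂ H) (p : Fin N → ι) :
    productBasis N e p = prodVec fun i => e (p i) := by
  simp [productBasis, prodVec]

theorem ext_inner_productBasis {N : ℕ} (e : OrthonormalBasis ι ℂ H) {Φ Ψ : TensorPow N H}
    (h : ∀ p, ⟪productBasis N e p, Φ⟫_ℂ = ⟪productBasis N e p, Ψ⟫_ℂ) : Φ = Ψ := by
  apply (productBasis N e).repr.injective
  ext p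
  rw [OrthonormalBasis.repr_apply_apply, OrthonormalBasis.repr_apply_apply, h]

theorem inner_permute {N : ℕ} (π : Equiv.Perm (Fin N)) (Φ Ψ : TensorPow N H) :
    ⟪permute π Φ, permute π Ψ⟫_ℂ = ⟪Φ, Ψ⟫_ℂ := by
  have h1 : Φ ∈ Submodule.span ℂ (Set.range (prodVec : (Fin N → H) → TensorPow N H)) := by
    rw [span_range_prodVec]; trivial
  have h2 : Ψ ∈ Submodule.span ℂ (Set.range (prodVec : (Fin N → H) → TensorPow N H)) := by
    rw [span_range_prodVec]; trivial
  induction h1, h2 using Submodule.span_induction₂ with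
  | mem_mem x y hx hy =>
    obtain ⟨x, rfl⟩ := hx
    obtain ⟨y, rfl⟩ := hy
    rw [permute_prodVec, permute_prodVec, inner_prodVec, inner_prodVec]
    exact Equiv.prod_comp π.symm fun i => ⟪x i, y i⟫_ℂ
  | zero_left => simp
  | zero_right => simp
  | add_left _ _ _ _ _ _ h1 h2 => simp [h1, h2]
  | add_right _ _ _ _ _ _ h1 h2 => simp [h1, h2]
  | smul_left _ _ _ _ _ h => simp [h]
  | smul_right _ _ _ _ _ h => simp [h]

theorem permute_productBasis {N : ℕ} (e : OrthonormalBasis ι ℂ H) (π : Equiv.Perm (Fin N))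
    (p : Fin N → ι) : permute π (productBasis N e (p ∘ π)) = productBasis N e p := by
  simp [productBasis_apply, permute_prodVec]

theorem inner_productBasis_permute {N : ℕ} (e : OrthonormalBasis ι ℂ H)
    (π : Equiv.Perm (Fin N)) (p : Fin N → ι) (Φ : TensorPow N H) :
    ⟪productBasis N e p, permute π Φ⟫_ℂ = ⟪productBasis N e (p ∘ π), Φ⟫_ℂ := by
  rw [← permute_productBasis e π p, inner_permute]

theorem mem_symSubspace_iff {N : ℕ} (e : OrthonormalBasis ι ℂ H) (Φ : TensorPow N H) :
    Φ ∈ symSubspace N H ↔ ∀ (π : Equiv.Perm (Fin N)) (p : Fin N → ι),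
      ⟪productBasis N e (p ∘ π), Φ⟫_ℂ = ⟪productBasis N e p, Φ⟫_ℂ := by
  refine ⟨fun h π p => ?_, fun h π => ?_⟩
  · rw [← inner_productBasis_permute, h π]
  · refine ext_inner_productBasis e fun p => ?_
    rw [inner_productBasis_permute, h π p]

theorem inner_powVec {N : ℕ} (x y : H) : ⟪powVec N x, powVec N y⟫_ℂ = ⟪x, y⟫_ℂ ^ N := by
  simp [powVec, inner_prodVec]

theorem norm_powVec {N : ℕ} (x : H) : ‖powVec N x‖ = ‖x‖ ^ N := by
  have h : ‖powVec N x‖ ^ 2 = (‖x‖ ^ N) ^ 2 := by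
    have := inner_powVec (N := N) x x
    rw [inner_self_eq_norm_sq_to_K, inner_self_eq_norm_sq_to_K] at this
    rw [← pow_mul, mul_comm N, pow_mul]
    exact_mod_cast this
  exact (sq_eq_sq₀ (norm_nonneg _) (by positivity)).1 h

/-- The symmetric subspace has dimension at most the number of multisets of size `N` in a set of
`dim H` elements. -/
theorem finrank_symSubspace_le (N : ℕ) :
    Module.finrank ℂ (symSubspace N H) ≤ (Module.finrank ℂ H).multichoose N := by
  classical
  let e := stdOrthonormalBasis ℂ H
  let t : (Fin N → Fin (Module.finrank ℂ H)) → Sym (Fin (Module.finrank ℂ H)) N :=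
    fun p => ⟨Finset.univ.val.map p, by simp⟩
  -- A symmetric vector has equal coordinates on words with the same letter counts, so one
  -- representative word per multiset determines it.
  let L : symSubspace N H →ₗ[ℂ] (Set.range t → ℂ) :=
    LinearMap.pi fun m => (innerₛₗ ℂ (productBasis N e m.2.choose)).comp (symSubspace N H).subtype
  have hL : Function.Injective L := by
    rw [← LinearMap.ker_eq_bot, LinearMap.ker_eq_bot']
    intro Φ hΦ
    apply Subtype.ext
    refine ext_inner_productBasis e fun p => ?_
    let m : Set.range t := ⟨t p, p, rfl⟩
    have hm : t m.2.choose = t p := m.2.choose_spec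
    have h0 : ⟪productBasis N e m.2.choose, (Φ : TensorPow N H)⟫_ℂ = 0 := congrFun hΦ m
    generalize m.2.choose = q at hm h0
    have hcard (c : Fin (Module.finrank ℂ H)) : Nonempty ({a // p a = c} ≃ {a // q a = c}) := by
      rw [← Fintype.card_eq, Fintype.card_subtype, Fintype.card_subtype]
      have := congrArg (fun m : Sym _ N => Multiset.count c (m : Multiset _)) hm
      simp only [t, Sym.coe_mk, Multiset.count_map] at this
      simp only [eq_comm (a := c)] at this
      exact this.symm
    let σ : Equiv.Perm (Fin N) := Equiv.ofFiberEquiv fun c => (hcard c).some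
    have hσ : q ∘ σ = p := funext fun a => Equiv.ofFiberEquiv_map _ a
    rw [← hσ, (mem_symSubspace_iff e (Φ : TensorPow N H)).1 Φ.2 σ q, h0]
    simp
  calc Module.finrank ℂ (symSubspace N H)
      ≤ Module.finrank ℂ (Set.range t → ℂ) :=
        LinearMap.finrank_le_finrank_of_injective hL
    _ = Fintype.card (Set.range t) := Module.finrank_fintype_fun_eq_card ℂ
    _ ≤ Fintype.card (Sym (Fin (Module.finrank ℂ H)) N) := set_fintype_card_le_univ _
    _ = _ := by rw [Sym.card_sym_eq_multichoose,
      Fintype.card_fin]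

end Bases

/-- Passing from `d` to `d + 1` multiplies the left side by `(d + k) / d`, which is at most `k` when
`d, k ≥ 2`; hence the induction starts at `d = 2`. -/
theorem multichoose_lt_pow {d k : ℕ} (hd : 1 ≤ d) (hk : 2 ≤ k) : d.multichoose k < k ^ d := by
  obtain rfl | hd : d = 1 ∨ 2 ≤ d := by omega
  · simp; omega
  induction d, hd using Nat.le_induction with
  | base => simp; nlinarith
  | succ d hd ih =>
    specialize ih (by omega)
    have h : d * (d + 1).multichoose k = (d + k) * d.multichoose k := by
      rw [Nat.multichoose_eq, Nat.multichoose_eq]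
      obtain ⟨a, rfl⟩ : ∃ a, d = a + 1 := ⟨d - 1, by omega⟩
      have := Nat.choose_mul_succ_eq (a + k) k
      rw [show a + 1 + k - 1 = a + k by omega, show a + 1 + 1 + k - 1 = a + k + 1 by omega]
      rw [show a + k + 1 - k = a + 1 by omega] at this
      linarith
    have h2 : d + k ≤ d * k := by nlinarith
    have h3 : d * (d + 1).multichoose k < d * k ^ (d + 1) := by
      rw [h, pow_succ]
      have : 0 < d * k := by positivity
      calc (d + k) * d.multichoose k ≤ (d * k) * d.multichoose k := Nat.mul_le_mul_right _ h2
        _ < (d * k) * k ^ d := Nat.mul_lt_mul_of_pos_left ih this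
        _ = _ := by ring
    exact lt_of_mul_lt_mul_left h3 (Nat.zero_le _)

/-! ### Compactness of convex hulls -/

theorem sum_extend_zero {α β M : Type*} [Fintype α] [Fintype β] [AddCommMonoid M] (f : α ↪ β)
    (g : α → M) : ∑ j, Function.extend f g 0 j = ∑ i, g i := by
  rw [← Finset.sum_subset (Finset.subset_univ (Finset.univ.map f)), Finset.sum_map]
  · simp [f.injective.extend_apply]
  · intro j _ hj
    rw [Function.extend_apply' _ _ _ fun ⟨a, ha⟩ => hj (by simp [← ha])]
    rfl

/-- Carathéodory's theorem with a number of points that depends on the dimension only. -/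
theorem exists_fin_convexCombination {E : Type*} [AddCommGroup E] [Module ℝ E]
    [FiniteDimensional ℝ E] {s : Set E} {x : E} (hx : x ∈ convexHull ℝ s) :
    ∃ w ∈ stdSimplex ℝ (Fin (Module.finrank ℝ E + 1)),
      ∃ z : Fin (Module.finrank ℝ E + 1) → E, (∀ i, z i ∈ s) ∧ ∑ i, w i • z i = x := by
  classical
  obtain ⟨ι, _, z, w, hz, haff, hw, hw1, hsum⟩ := eq_pos_convex_span_of_mem_convexHull hx
  have hcard : Fintype.card ι ≤ Fintype.card (Fin (Module.finrank ℝ E + 1)) := by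
    rw [Fintype.card_fin]
    exact haff.card_le_finrank_succ.trans (Nat.succ_le_succ (Submodule.finrank_le _))
  obtain ⟨f⟩ := Function.Embedding.nonempty_of_card_le hcard
  have hne : Nonempty ι := by
    by_contra h
    rw [not_nonempty_iff] at h
    simp at hw1
  -- Spare slots get weight 0 and an arbitrary point of `s`.
  refine ⟨Function.extend f w 0, ⟨fun j => ?_, (sum_extend_zero f w).trans hw1⟩,
    Function.extend f z fun _ => z hne.some, fun j => ?_, ?_⟩
  · by_cases h : ∃ a, f a = j
    · obtain ⟨a, rfl⟩ := h
      rw [f.injective.extend_apply]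
      exact (hw a).le
    · rw [Function.extend_apply' _ _ _ h]
      rfl
  · by_cases h : ∃ a, f a = j
    · obtain ⟨a, rfl⟩ := h
      rw [f.injective.extend_apply]
      exact hz ⟨a, rfl⟩
    · rw [Function.extend_apply' _ _ _ h]
      exact hz ⟨_, rfl⟩
  · rw [← hsum, ← sum_extend_zero f fun i => w i • z i]
    refine Finset.sum_congr rfl fun j _ => ?_
    by_cases h : ∃ a, f a = j
    · obtain ⟨a, rfl⟩ := h
      simp [f.injective.extend_apply]
    · simp [Function.extend_apply' _ _ _ h]

/-- With the number of points bounded, the hull is a continuous image of a simplex times a power of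
`s`. -/
theorem isCompact_convexHull_of_finiteDimensional {E : Type*} [NormedAddCommGroup E]
    [NormedSpace ℝ E] [FiniteDimensional ℝ E] {s : Set E} (hs : IsCompact s) :
    IsCompact (convexHull ℝ s) := by
  let m := Module.finrank ℝ E + 1
  have h := ((isCompact_stdSimplex ℝ (Fin m)).prod (isCompact_univ_pi fun _ : Fin m => hs)).image
    (f := fun p : (Fin m → ℝ) × (Fin m → E) => ∑ i, p.1 i • p.2 i) (by fun_prop)
  convert h using 1
  refine Set.Subset.antisymm (fun x hx => ?_) ?_
  · obtain ⟨w, hw, z, hz, rfl⟩ := exists_fin_convexCombination hx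
    exact ⟨(w, z), ⟨hw, fun i _ => hz i⟩, rfl⟩
  · rintro _ ⟨⟨w, z⟩, ⟨hw, hz⟩, rfl⟩
    exact mem_convexHull_of_exists_fintype w z hw.1 hw.2 (fun i => hz i trivial) rfl

/-! ### Finite tight frames of powers -/

variable {H : Type*} [NormedAddCommGroup H] [InnerProductSpace ℂ H] [FiniteDimensional ℂ H]

theorem exists_orthonormalBasis_zero_eq {m : ℕ} (hm : Module.finrank ℂ H = m + 1) {ν : H}
    (hν : ‖ν‖ = 1) : ∃ e : OrthonormalBasis (Fin (m + 1)) ℂ H, e 0 = ν := by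
  have h : Orthonormal ℂ (({0} : Set (Fin (m + 1))).domRestrict fun _ => ν) := by
    refine ⟨fun i => hν, fun i j hij => (hij (Subsingleton.elim i j)).elim⟩
  obtain ⟨b, hb⟩ := h.exists_orthonormalBasis_extension_of_card_eq (by simpa using hm)
  exact ⟨b, hb 0 rfl⟩

theorem exists_linearIsometryEquiv_apply_eq {μ ν : H} (hμ : ‖μ‖ = 1) (hν : ‖ν‖ = 1) :
    ∃ U : H ≃ₗᵢ[ℂ] H, U μ = ν := by
  obtain ⟨m, hm⟩ : ∃ m, Module.finrank ℂ H = m + 1 := by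
    have : Nontrivial H := ⟨μ, 0, fun h => by simp [h] at hμ⟩
    exact Nat.exists_eq_succ_of_ne_zero Module.finrank_pos.ne'
  obtain ⟨a, rfl⟩ := exists_orthonormalBasis_zero_eq hm hμ
  obtain ⟨b, rfl⟩ := exists_orthonormalBasis_zero_eq hm hν
  exact ⟨a.equiv b (Equiv.refl _), by simp⟩

/-- The matrix of the rank one operator `|ν^{⊗N}⟩⟨ν^{⊗N}|` as a vector of a Euclidean space. -/
noncomputable def powMatrix (N : ℕ) (ν : H) :
    EuclideanSpace ℂ ((Fin N → Fin (Module.finrank ℂ H)) × (Fin N → Fin (Module.finrank ℂ H))) :=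
  WithLp.toLp 2 fun p => ⟪productBasis N (stdOrthonormalBasis ℂ H) p.1, powVec N ν⟫_ℂ *
    ⟪powVec N ν, productBasis N (stdOrthonormalBasis ℂ H) p.2⟫_ℂ

/-- This is the Hilbert–Schmidt product of two rank one operators. It depends only on `|⟨μ, ν⟩|`,
hence is unitarily invariant. -/
theorem inner_powMatrix (N : ℕ) (μ ν : H) :
    ⟪powMatrix N μ, powMatrix N ν⟫_ℂ = ((‖⟪μ, ν⟫_ℂ‖ ^ (2 * N) : ℝ) : ℂ) := by
  have h : ⟪powMatrix N μ, powMatrix N ν⟫_ℂ =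
      ⟪powVec N μ, powVec N ν⟫_ℂ * ⟪powVec N ν, powVec N μ⟫_ℂ := by
    rw [← (productBasis N (stdOrthonormalBasis ℂ H)).sum_inner_mul_inner (powVec N μ),
      ← (productBasis N (stdOrthonormalBasis ℂ H)).sum_inner_mul_inner (powVec N ν),
      Finset.sum_mul_sum, PiLp.inner_apply, Fintype.sum_prod_type]
    refine Finset.sum_congr rfl fun p _ => Finset.sum_congr rfl fun q _ => ?_
    simp only [powMatrix, RCLike.inner_apply, map_mul, inner_conj_symm]
    ring
  rw [h, inner_powVec, inner_powVec, ← mul_pow, ← inner_conj_symm ν μ, Complex.mul_conj,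
    Complex.normSq_eq_norm_sq, pow_mul]
  push_cast
  rfl

theorem continuous_powMatrix (N : ℕ) : Continuous (powMatrix (H := H) N) := by
  refine (PiLp.continuous_toLp 2 _).comp (continuous_pi fun p => ?_)
  have h (q : Fin N → Fin (Module.finrank ℂ H)) : Continuous fun ν : H =>
      ⟪productBasis N (stdOrthonormalBasis ℂ H) q, powVec N ν⟫_ℂ := by
    simp only [productBasis_apply, powVec, inner_prodVec]
    fun_prop
  refine (h p.1).mul ?_
  simpa only [Function.comp_def, inner_conj_symm] using Complex.continuous_conj.comp (h p.2)

/-- A finite convex combination of unit vectors for which the average of `|⟨ν, μ⟩|^{2N}` does not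
depend on the unit vector `μ`: it minimises the frame potential. -/
theorem exists_average_const (N : ℕ) {ν₀ : H} (hν₀ : ‖ν₀‖ = 1) :
    ∃ (m : ℕ) (w : Fin m → ℝ) (z : Fin m → H), (∀ i, 0 ≤ w i) ∧ ∑ i, w i = 1 ∧
      (∀ i, ‖z i‖ = 1) ∧ ∃ c : ℝ, ∀ μ : H, ‖μ‖ = 1 → ∑ i, w i * ‖⟪z i, μ⟫_ℂ‖ ^ (2 * N) = c := by
  have : ProperSpace H := FiniteDimensional.proper ℂ H
  let s : Set H := Metric.sphere 0 1
  let K := convexHull ℝ (powMatrix N '' s)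
  have hK : IsCompact K := isCompact_convexHull_of_finiteDimensional
    ((isCompact_sphere 0 1).image (continuous_powMatrix N))
  have hmem (ν : H) (hν : ‖ν‖ = 1) : powMatrix N ν ∈ powMatrix N '' s :=
    ⟨ν, by simpa [s] using hν, rfl⟩
  obtain ⟨X, hXK, hX⟩ := hK.exists_isMinOn ⟨_, subset_convexHull ℝ _ (hmem ν₀ hν₀)⟩
    continuous_norm.continuousOn
  obtain ⟨w, hw, y, hy, hwy⟩ := exists_fin_convexCombination hXK
  choose z hz hzy using hy
  have hz1 (i) : ‖z i‖ = 1 := by simpa [s] using hz i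
  obtain rfl : (fun i => powMatrix N (z i)) = y := funext hzy
  refine ⟨_, w, z, hw.1, hw.2, hz1, ∑ i, w i * ‖⟪z i, ν₀⟫_ℂ‖ ^ (2 * N), fun μ hμ => ?_⟩
  have hin (u : Fin _ → H) (μ : H) : ⟪∑ i, w i • powMatrix N (u i), powMatrix N μ⟫_ℂ =
      ((∑ i, w i * ‖⟪u i, μ⟫_ℂ‖ ^ (2 * N) : ℝ) : ℂ) := by
    simp_rw [sum_inner, ← Complex.coe_smul, inner_smul_left, inner_powMatrix]
    push_cast
    simp
  -- The norm is a function of the Gram matrix of the `z i`, which `U` preserves.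
  have hnorm (U : H ≃ₗᵢ[ℂ] H) : ‖∑ i, w i • powMatrix N (U (z i))‖ = ‖X‖ := by
    have h (u : Fin _ → H) : ⟪∑ i, w i • powMatrix N (u i), ∑ i, w i • powMatrix N (u i)⟫_ℂ =
        ∑ j, w j * ((∑ i, w i * ‖⟪u i, u j⟫_ℂ‖ ^ (2 * N) : ℝ) : ℂ) := by
      simp_rw [inner_sum _ _ (∑ i, w i • powMatrix N (u i)), ← hin, ← Complex.coe_smul,
        inner_smul_right]
    have h2 : (‖∑ i, w i • powMatrix N (U (z i))‖ : ℂ) ^ 2 = (‖X‖ : ℂ) ^ 2 := by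
      have hself (v : EuclideanSpace ℂ ((Fin N → Fin (Module.finrank ℂ H)) ×
          (Fin N → Fin (Module.finrank ℂ H)))) : (‖v‖ : ℂ) ^ 2 = ⟪v, v⟫_ℂ :=
        (inner_self_eq_norm_sq_to_K v).symm
      rw [← hwy, hself, hself, h, h]
      simp
    exact (sq_eq_sq₀ (norm_nonneg _) (norm_nonneg _)).1 (by exact_mod_cast h2)
  obtain ⟨U, hU⟩ := exists_linearIsometryEquiv_apply_eq hν₀ hμ
  set Y := ∑ i, w i • powMatrix N (U (z i)) with hY
  have hYK : Y ∈ K := mem_convexHull_of_exists_fintype w _ hw.1 hw.2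
    (fun i => hmem _ (by simp [hz1])) rfl
  -- `X` and its rotation `Y` are both minimisers, so the parallelogram law at their midpoint forces
  -- `X = Y`.
  have hmid : (1 / 2 : ℝ) • X + (1 / 2 : ℝ) • Y ∈ K :=
    convex_convexHull ℝ _ hXK hYK (by norm_num) (by norm_num) (by norm_num)
  have h1 : ‖X‖ ≤ ‖X + Y‖ / 2 := by
    have := hX hmid
    simp only [Set.mem_ofPred_eq] at this
    rw [← smul_add, norm_smul] at this
    norm_num at this
    linarith
  have hXY : X = Y := by
    have := parallelogram_law_with_norm ℂ X Y
    rw [hY, hnorm U, ← hY] at this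
    have h2 : ‖X - Y‖ ^ 2 ≤ 0 := by nlinarith [norm_nonneg X]
    rw [← sub_eq_zero, ← norm_eq_zero]
    exact pow_eq_zero_iff two_ne_zero |>.1 (le_antisymm h2 (sq_nonneg _))
  -- Pairing `X = Y` with the power of `μ = U ν₀` moves `U` away and leaves the value at `ν₀`.
  have h3 := hin z μ
  rw [hwy, hXY, hY, hin, ← hU] at h3
  simp only [LinearIsometryEquiv.inner_map_map] at h3
  rw [← hU]
  exact_mod_cast h3.symm

theorem powVec_add_smul {H : Type*} [AddCommGroup H] [Module ℂ H] (N : ℕ) (s : ℂ) (x y : H) : powVec N (x + s • y) =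
    ∑ S : Finset (Fin N), s ^ (N - S.card) • prodVec (S.piecewise (fun _ => x) fun _ => y) := by
  have h := (prodVecMultilinear N H).map_add_univ (fun _ => x) (fun _ => s • y)
  simp only [prodVecMultilinear_apply] at h
  refine h.trans (Finset.sum_congr rfl fun S _ => ?_)
  have h2 : S.piecewise (fun _ => x) (fun _ => s • y) =
      fun i => (S.piecewise (fun _ => (1 : ℂ)) fun _ => s) i •
        S.piecewise (fun _ => x) (fun _ => y) i := by
    funext i
    by_cases hi : i ∈ S <;> simp [hi]
  rw [h2, ← prodVecMultilinear_apply, MultilinearMap.map_smul_univ, prodVecMultilinear_apply]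
  congr 1
  rw [Finset.prod_piecewise]
  simp [← Finset.compl_eq_univ_sdiff, Finset.card_compl]

theorem sum_pow_eq_ite_dvd {M : ℕ} {ω : ℂ} (hω : IsPrimitiveRoot ω M) (n : ℕ) :
    ∑ j ∈ Finset.range M, (ω ^ j) ^ n = if M ∣ n then (M : ℂ) else 0 := by
  simp_rw [← pow_mul, mul_comm _ n, pow_mul]
  split_ifs with h
  · rw [(hω.pow_eq_one_iff_dvd n).2 h]
    simp
  · have h1 : ω ^ n - 1 ≠ 0 := sub_ne_zero.2 fun h2 => h ((hω.pow_eq_one_iff_dvd n).1 h2)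
    have h2 := mul_geom_sum (ω ^ n) M
    rw [← pow_mul, mul_comm n, pow_mul, hω.pow_eq_one, one_pow, sub_self] at h2
    exact (mul_eq_zero.1 h2).resolve_left h1

/-- A sesquilinear form that vanishes on the diagonal of the powers vanishes on the symmetric
subspace. -/
theorem inner_eq_zero_of_inner_powVec_eq_zero {N : ℕ} (A : TensorPow N H →ₗ[ℂ] TensorPow N H)
    (hA : ∀ z : H, ⟪powVec N z, A (powVec N z)⟫_ℂ = 0) {x y : TensorPow N H}
    (hx : x ∈ symSubspace N H) (hy : y ∈ symSubspace N H) : ⟪x, A y⟫_ℂ = 0 := by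
  have key (x y : H) : ⟪powVec N x, A (powVec N y)⟫_ℂ = 0 := by
    -- The phase `ω^j` enters the expansion at `x + ω^j y` with exponents from `-N` to `N`, which
    -- `M`-th roots of unity separate. Conjugation becomes the power `2N`, so exponents stay
    -- natural.
    obtain ⟨M, hM⟩ : ∃ M, M = 2 * N + 1 := ⟨_, rfl⟩
    have hM0 : M ≠ 0 := by omega
    have hω := Complex.isPrimitiveRoot_exp M hM0
    set ω := Complex.exp (2 * Real.pi * Complex.I / M)
    have hconj (j : ℕ) : (starRingEnd ℂ) (ω ^ j) = (ω ^ j) ^ (2 * N) := by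
      have h1 : (ω ^ j) * (ω ^ j) ^ (2 * N) = 1 := by
        rw [← pow_succ', ← hM, ← pow_mul, mul_comm, pow_mul, hω.pow_eq_one, one_pow]
      have h2 : ‖ω ^ j‖ = 1 := by rw [norm_pow, hω.norm'_eq_one hM0, one_pow]
      rw [← Complex.inv_eq_conj h2]
      exact inv_eq_of_mul_eq_one_right h1
    -- The prefactor equals `(ω ^ j) ^ (-N)`; averaging over `j` then isolates the term with `x`
    -- everywhere on the left and `y` everywhere on the right.
    have hexp (j : ℕ) : (ω ^ j) ^ (2 * N * N) *
        ⟪powVec N (x + ω ^ j • y), A (powVec N (x + ω ^ j • y))⟫_ℂ =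
        ∑ S : Finset (Fin N), ∑ T : Finset (Fin N),
          (ω ^ j) ^ (2 * N * (N + (N - S.card)) + (N - T.card)) *
          ⟪prodVec (S.piecewise (fun _ => x) fun _ => y),
            A (prodVec (T.piecewise (fun _ => x) fun _ => y))⟫_ℂ := by
      rw [powVec_add_smul, map_sum, sum_inner, Finset.mul_sum]
      refine Finset.sum_congr rfl fun S _ => ?_
      rw [inner_sum, Finset.mul_sum]
      refine Finset.sum_congr rfl fun T _ => ?_
      rw [map_smul, inner_smul_left, inner_smul_right, map_pow, hconj]
      ring
    have hsum := Finset.sum_congr rfl fun j (_ : j ∈ Finset.range M) => hexp j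
    simp_rw [hA, mul_zero, Finset.sum_const_zero] at hsum
    rw [Finset.sum_comm] at hsum
    simp_rw [Finset.sum_comm (s := Finset.range M), ← Finset.sum_mul,
      sum_pow_eq_ite_dvd hω] at hsum
    have hdvd (S T : Finset (Fin N)) :
        M ∣ 2 * N * (N + (N - S.card)) + (N - T.card) ↔ S = Finset.univ ∧ T = ∅ := by
      have hS : S.card ≤ N := S.card_le_univ.trans_eq (Fintype.card_fin N)
      have hT : T.card ≤ N := T.card_le_univ.trans_eq (Fintype.card_fin N)
      have hS' : S = Finset.univ ↔ S.card = N := by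
        rw [← Finset.card_eq_iff_eq_univ, Fintype.card_fin]
      rw [hS', ← Finset.card_eq_zero]
      obtain ⟨a, ha⟩ : ∃ a, a = N - S.card := ⟨_, rfl⟩
      obtain ⟨b, hb⟩ : ∃ b, b = N - T.card := ⟨_, rfl⟩
      have h1 : S.card = N ∧ T.card = 0 ↔ N + a - b = 0 := by omega
      have h2 : 2 * N * (N + a) + b + (N + a - b) = M * (N + a) := by
        have : b + (N + a - b) = N + a := by omega
        rw [add_assoc, this, hM]
        ring
      rw [← ha, ← hb, h1]
      refine ⟨fun h => Nat.eq_zero_of_dvd_of_lt ((Nat.dvd_add_right h).1 ?_) (by omega),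
        fun h => ?_⟩
      · exact h2 ▸ dvd_mul_right M _
      · rw [h, add_zero] at h2
        exact h2 ▸ dvd_mul_right M _
    simp_rw [hdvd] at hsum
    rw [Finset.sum_eq_single Finset.univ (fun S _ hS => by simp [hS]) (by simp),
      Finset.sum_eq_single ∅ (fun S _ hS => by simp [hS]) (by simp)] at hsum
    simp only [and_self, if_true, Finset.piecewise_univ, Finset.piecewise_empty] at hsum
    exact (mul_eq_zero.1 hsum.symm).resolve_left (Nat.cast_ne_zero.2 hM0)
  rw [symSubspace_eq_span_powVec] at hx hy
  induction hx, hy using Submodule.span_induction₂ with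
  | mem_mem x y hx hy =>
    obtain ⟨x, rfl⟩ := hx
    obtain ⟨y, rfl⟩ := hy
    exact key x y
  | zero_left => simp
  | zero_right => simp
  | add_left _ _ _ _ _ _ h1 h2 => simp [h1, h2]
  | add_right _ _ _ _ _ _ h1 h2 => simp [h1, h2]
  | smul_left _ _ _ _ _ h => simp [h]
  | smul_right _ _ _ _ _ h => simp [h]

/-- Finitely many vectors `ν^{⊗N}` with nonnegative weights form a tight frame of the symmetric
subspace. -/
theorem exists_weighted_frame (N : ℕ) {ν₀ : H} (hν₀ : ‖ν₀‖ = 1) :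
    ∃ (m : ℕ) (w : Fin m → ℝ) (z : Fin m → H), (∀ i, 0 ≤ w i) ∧ (∀ i, ‖z i‖ = 1) ∧
      ∀ x ∈ symSubspace N H, ∑ i, w i * ‖⟪powVec N (z i), x⟫_ℂ‖ ^ 2 = ‖x‖ ^ 2 := by
  obtain ⟨m, w, z, hw, hw1, hz, c, hc⟩ := exists_average_const N hν₀
  have hc0 : 0 < c := by
    obtain ⟨i, -, hi⟩ : ∃ i ∈ Finset.univ, 0 < w i := by
      by_contra! h
      have := Finset.sum_nonpos h
      rw [hw1] at this
      norm_num at this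
    rw [← hc (z i) (hz i)]
    refine Finset.sum_pos' (fun j _ => mul_nonneg (hw j) (by positivity)) ⟨i, Finset.mem_univ _, ?_⟩
    rw [inner_self_eq_norm_sq_to_K, hz]
    simpa using hi
  have hcμ (μ : H) : ∑ i, w i * ‖⟪z i, μ⟫_ℂ‖ ^ (2 * N) = c * ‖μ‖ ^ (2 * N) := by
    by_cases hμ : μ = 0
    -- At `μ = 0` the case `N = 0` is special, since `0 ^ 0 = 1`.
    · subst hμ
      by_cases hN : N = 0
      · subst hN
        simpa [hw1] using hc ν₀ hν₀
      · simp [hN]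
    · have hμ' : ‖μ‖ ≠ 0 := norm_ne_zero_iff.2 hμ
      rw [← hc (((‖μ‖⁻¹ : ℝ) : ℂ) • μ) (by rw [norm_smul]; simp [hμ']), Finset.sum_mul]
      refine Finset.sum_congr rfl fun i _ => ?_
      rw [inner_smul_right, norm_mul, mul_assoc, ← mul_pow]
      congr 2
      simp
      field_simp
  -- Frame operator minus `c`: its form vanishes on powers by the constant average, hence on all
  -- symmetric vectors.
  let A : TensorPow N H →ₗ[ℂ] TensorPow N H :=
    (∑ i, (w i : ℂ) • (innerₛₗ ℂ (powVec N (z i))).smulRight (powVec N (z i))) -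
      (c : ℂ) • LinearMap.id
  have hA (x y : TensorPow N H) : ⟪x, A y⟫_ℂ =
      ∑ i, (w i : ℂ) * (⟪powVec N (z i), y⟫_ℂ * ⟪x, powVec N (z i)⟫_ℂ) - c * ⟪x, y⟫_ℂ := by
    simp [A]
  have hAx (x : TensorPow N H) : ⟪x, A x⟫_ℂ =
      ((∑ i, w i * ‖⟪powVec N (z i), x⟫_ℂ‖ ^ 2 - c * ‖x‖ ^ 2 : ℝ) : ℂ) := by
    rw [hA, inner_self_eq_norm_sq_to_K]
    push_cast
    congr 1
    refine Finset.sum_congr rfl fun i _ => ?_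
    rw [← inner_conj_symm x, Complex.mul_conj, Complex.normSq_eq_norm_sq]
    push_cast
    rfl
  have hA0 (μ : H) : ⟪powVec N μ, A (powVec N μ)⟫_ℂ = 0 := by
    rw [hAx, norm_powVec, ← pow_mul, mul_comm N 2, ← hcμ]
    simp_rw [inner_powVec, norm_pow, ← pow_mul, mul_comm N 2]
    simp
  refine ⟨m, fun i => w i / c, z, fun i => div_nonneg (hw i) hc0.le, hz, fun x hx => ?_⟩
  have h := inner_eq_zero_of_inner_powVec_eq_zero A hA0 hx hx
  rw [hAx, Complex.ofReal_eq_zero, sub_eq_zero] at h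
  simp_rw [div_mul_eq_mul_div]
  rw [← Finset.sum_div, h]
  field_simp

/-- The frame of `exists_weighted_frame`, indexed by an arbitrarily large finite set of unit
vectors. -/
theorem exists_finset_frame (N M : ℕ) {ν₀ : H} (hν₀ : ‖ν₀‖ = 1) :
    ∃ V : Finset H, (∀ ν ∈ V, ‖ν‖ = 1) ∧ M ≤ V.card ∧ ∃ w : H → ℝ, (∀ ν, 0 ≤ w ν) ∧
      ∀ x ∈ symSubspace N H, ∑ ν ∈ V, w ν * ‖⟪powVec N ν, x⟫_ℂ‖ ^ 2 = ‖x‖ ^ 2 := by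
  classical
  obtain ⟨m, w, z, hw, hz, hx⟩ := exists_weighted_frame N hν₀
  -- Phase multiples of one unit vector suffice, even in dimension one.
  have hinf : (Metric.sphere (0 : H) 1).Infinite := by
    have h1 : Function.Injective fun t : Circle => (t : ℂ) • ν₀ := by
      intro s t hst
      have hν : ν₀ ≠ 0 := fun h => by simp [h] at hν₀
      exact Subtype.ext (smul_left_injective ℂ hν hst)
    have : Infinite Circle := by
      refine Infinite.of_injective (fun n : ℕ => Circle.exp (1 / (n + 1))) fun a b hab => ?_
      have harg (n : ℕ) : Complex.arg (Circle.exp (1 / ((n : ℝ) + 1))) = 1 / ((n : ℝ) + 1) := by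
        have h1 : 1 / ((n : ℝ) + 1) ≤ 1 := by
          rw [div_le_one (by positivity)]
          linarith [Nat.cast_nonneg (α := ℝ) n]
        have h2 : 0 < 1 / ((n : ℝ) + 1) := by positivity
        exact Circle.arg_exp (by linarith [Real.pi_pos]) (by linarith [Real.pi_gt_three])
      have h := congrArg (fun t : Circle => Complex.arg t) hab
      simp only [harg] at h
      simpa using h
    exact (Set.infinite_range_of_injective h1).mono (by rintro _ ⟨t, rfl⟩; simp [norm_smul, hν₀, Circle.norm_coe])
  obtain ⟨V₀, hV₀, hcard⟩ := hinf.exists_subset_card_eq M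
  -- Weights of coinciding `z i` are added; padding vectors outside the image of `z` get the empty
  -- sum 0.
  refine ⟨Finset.univ.image z ∪ V₀, fun ν hν => ?_, ?_,
    fun ν => ∑ i with z i = ν, w i, fun ν => Finset.sum_nonneg fun i _ => hw i, fun x hxs => ?_⟩
  · rcases Finset.mem_union.1 hν with h | h
    · obtain ⟨i, -, rfl⟩ := Finset.mem_image.1 h
      exact hz i
    · simpa using hV₀ h
  · exact hcard.ge.trans (Finset.card_le_card Finset.subset_union_right)
  · rw [← hx x hxs, ← Finset.sum_fiberwise_of_maps_to (g := z)
      (t := Finset.univ.image z ∪ V₀) (fun i _ => by simp)]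
    refine Finset.sum_congr rfl fun ν _ => ?_
    rw [Finset.sum_mul]
    refine Finset.sum_congr rfl fun i hi => ?_
    rw [(Finset.mem_filter.1 hi).2]

/-- The total weight of a tight frame of powers is the dimension of the symmetric subspace. -/
theorem sum_weights_eq_finrank {N : ℕ} {V : Finset H} (hV : ∀ ν ∈ V, ‖ν‖ = 1) {w : H → ℝ}
    (hw : ∀ x ∈ symSubspace N H, ∑ ν ∈ V, w ν * ‖⟪powVec N ν, x⟫_ℂ‖ ^ 2 = ‖x‖ ^ 2) :
    ∑ ν ∈ V, w ν = Module.finrank ℂ (symSubspace N H) := by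
  let b := stdOrthonormalBasis ℂ (symSubspace N H)
  -- This is the trace of the frame identity; each `ν^{⊗N}` contributes its squared norm 1.
  have h1 : ∑ j, ∑ ν ∈ V, w ν * ‖⟪powVec N ν, (b j : TensorPow N H)⟫_ℂ‖ ^ 2 =
      Module.finrank ℂ (symSubspace N H) := by
    have hb (j) : ‖(b j : TensorPow N H)‖ = 1 := b.norm_eq_one j
    rw [Finset.sum_congr rfl fun j _ => hw (b j) (b j).2]
    simp [hb]
  rw [← h1, Finset.sum_comm]
  refine Finset.sum_congr rfl fun ν hν => ?_
  have h2 := b.sum_sq_norm_inner_left ⟨powVec N ν, powVec_mem_symSubspace N ν⟩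
  change _ = ‖powVec N ν‖ ^ 2 at h2
  rw [norm_powVec, hV ν hν, one_pow, one_pow] at h2
  exact Eq.symm <| (Finset.mul_sum Finset.univ _ (w ν)).symm.trans ((congrArg (w ν * ·) h2).trans (mul_one _))

/-! ### Exponential tail bound for invariant weights on words -/

/-- If a nonnegative permutation invariant function on words of length `N` is supported on words
with at least `a` letters different from `o`, then the part of its mass on words that start with
`j` letters `o` is exponentially small. -/
theorem sum_prefix_le_exp {N : ℕ} {ι : Type*} [Fintype ι] [DecidableEq ι] (o : ι) (a : ℕ)
    (g : (Fin N → ι) → ℝ) (hg : ∀ p, 0 ≤ g p) (hperm : ∀ (π : Equiv.Perm (Fin N)) p, g (p ∘ π) = g p)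
    (hsupp : ∀ p, (Finset.univ.filter fun i => p i ≠ o).card < a → g p = 0) (j : ℕ) (hj : j ≤ N) :
    ∑ p with ∀ i : Fin N, i.1 < j → p i = o, g p ≤ Real.exp (-((j : ℝ) * a / N)) * ∑ p, g p := by
  induction j with
  | zero => simp
  | succ j ih =>
    have hjN : j < N := hj
    set S := ∑ p with ∀ i : Fin N, i.1 < j → p i = o, g p with hS
    set S' := ∑ p with ∀ i : Fin N, i.1 < j + 1 → p i = o, g p with hS'
    have hS0 : 0 ≤ S := Finset.sum_nonneg fun p _ => hg p
    let c : Fin N := ⟨j, hjN⟩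
    let A : Finset (Fin N) := Finset.univ.filter fun i => j ≤ i.1
    have hA : (A.card : ℝ) = N - j := by
      have : A = Finset.Ici c := by ext i; simp [A, c, Fin.le_def]
      rw [this, Fin.card_Ici, Nat.cast_sub hjN.le]
    -- By invariance, every position outside the prefix is as good as position `j` for the next
    -- letter `o`.
    have hswap (i : Fin N) (hi : i ∈ A) :
        ∑ p with (∀ i : Fin N, i.1 < j → p i = o) ∧ p i = o, g p = S' := by
      have hi' : j ≤ i.1 := (Finset.mem_filter.1 hi).2
      refine Finset.sum_equiv ((Equiv.swap c i).arrowCongr (Equiv.refl ι)) (fun p => ?_) fun p _ => ?_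
      · have hlt (l : Fin N) (hl : l.1 < j) : Equiv.swap c i l = l :=
          Equiv.swap_apply_of_ne_of_ne (fun h => by simp [h, c] at hl) fun h => by
            rw [h] at hl; omega
        simp only [Finset.mem_filter, Finset.mem_univ, true_and, Equiv.arrowCongr_apply,
          Equiv.symm_swap, Function.comp_apply, Equiv.refl_apply]
        constructor
        · rintro ⟨h1, h2⟩ l hl
          rcases Nat.lt_succ_iff_lt_or_eq.1 hl with h | h
          · rw [hlt l h]; exact h1 l h
          · rw [show l = c from Fin.ext h, Equiv.swap_apply_left]; exact h2
        · intro h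
          refine ⟨fun l hl => ?_, ?_⟩
          · have := h l (by omega)
            rwa [hlt l hl] at this
          · have := h c (Nat.lt_succ_self j)
            rwa [Equiv.swap_apply_left] at this
      · exact (hperm (Equiv.swap c i) p).symm
    -- Double counting: in the support, at most `N - j - a` of the remaining `N - j` positions carry
    -- `o`.
    have h1 : (N - j : ℝ) * S' ≤ (N - j - a) * S := by
      calc (N - j : ℝ) * S' =
          ∑ i ∈ A, ∑ p with (∀ i : Fin N, i.1 < j → p i = o) ∧ p i = o, g p := by
            rw [Finset.sum_congr rfl hswap, Finset.sum_const, nsmul_eq_mul, hA]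
        _ = ∑ p with ∀ i : Fin N, i.1 < j → p i = o, ((A.filter fun i => p i = o).card : ℝ) * g p := by
            simp_rw [← Finset.filter_filter, Finset.sum_filter (fun p : Fin N → ι => p _ = o)]
            rw [Finset.sum_comm]
            refine Finset.sum_congr rfl fun p _ => ?_
            rw [← Finset.sum_filter, Finset.sum_const, nsmul_eq_mul]
        _ ≤ ∑ p with ∀ i : Fin N, i.1 < j → p i = o, (N - j - a : ℝ) * g p := by
            refine Finset.sum_le_sum fun p hp => ?_
            by_cases hlt : (Finset.univ.filter fun i => p i ≠ o).card < a
            · rw [hsupp p hlt, mul_zero, mul_zero]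
            · refine mul_le_mul_of_nonneg_right ?_ (hg p)
              have hsub : (Finset.univ.filter fun i => p i ≠ o) = A.filter fun i => ¬ p i = o := by
                ext i
                simp only [A, Finset.mem_filter, Finset.mem_univ, true_and]
                refine ⟨fun h => ⟨?_, h⟩, fun h => h.2⟩
                by_contra hij
                exact h ((Finset.mem_filter.1 hp).2 i (not_le.1 hij))
              have hcard := Finset.card_filter_add_card_filter_not (s := A) fun i => p i = o
              rw [← hsub] at hcard
              have h2 : (a : ℝ) ≤ ((Finset.univ.filter fun i => p i ≠ o).card : ℝ) := by
                exact_mod_cast not_lt.1 hlt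
              have h3 : (((A.filter fun i => p i = o).card : ℝ)) +
                  ((Finset.univ.filter fun i => p i ≠ o).card : ℝ) = A.card := by
                exact_mod_cast hcard
              rw [hA] at h3
              linarith
        _ = _ := by rw [← Finset.mul_sum]
    have hNj : (0 : ℝ) < N - j := by
      have : (j : ℝ) < N := by exact_mod_cast hjN
      linarith
    have hN : (0 : ℝ) < N := by
      have : (0 : ℝ) ≤ j := Nat.cast_nonneg j
      linarith
    have h2 : S' ≤ Real.exp (-(a / N)) * S := by
      have h3 : S' ≤ (1 - a / (N - j)) * S := by
        rw [← mul_le_mul_iff_right₀ hNj]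
        refine h1.trans_eq ?_
        field_simp
      have h4 : (a : ℝ) / N ≤ a / (N - j) :=
        div_le_div_of_nonneg_left (Nat.cast_nonneg a) hNj (by linarith [Nat.cast_nonneg (α := ℝ) j])
      have h5 := Real.add_one_le_exp (-((a : ℝ) / N))
      exact h3.trans (mul_le_mul_of_nonneg_right (by linarith) hS0)
    calc S' ≤ Real.exp (-(a / N)) * S := h2
      _ ≤ Real.exp (-(a / N)) * (Real.exp (-((j : ℝ) * a / N)) * ∑ p, g p) :=
        mul_le_mul_of_nonneg_left (ih hjN.le) (Real.exp_nonneg _)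
      _ = _ := by
        rw [← mul_assoc, ← Real.exp_add]
        congr 2
        push_cast
        ring

/-! ### Contraction with a power and the restricted symmetric subspace -/

theorem split_powVec {H : Type*} [AddCommGroup H] [Module ℂ H] {N a b : ℕ} (h : a + b = N)
    (z : H) :
    split h (powVec N z) = powVec a z ⊗ₜ powVec b z := by
  rw [← LinearEquiv.eq_symm_apply, powVec, powVec, powVec, split_symm_prodVec]
  congr 1
  funext i
  refine Fin.addCases (fun i => ?_) (fun i => ?_) (Fin.cast h.symm i) <;> simp

/-- The partial inner product `⟨x| ⊗ 1`. -/
noncomputable def contract {E F : Type*} [NormedAddCommGroup E] [InnerProductSpace ℂ E]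
    [AddCommGroup F] [Module ℂ F] (x : E) : E ⊗[ℂ] F →ₗ[ℂ] F :=
  (TensorProduct.lid ℂ F).toLinearMap ∘ₗ (innerₛₗ ℂ x).rTensor F

theorem contract_tmul {E F : Type*} [NormedAddCommGroup E] [InnerProductSpace ℂ E]
    [AddCommGroup F] [Module ℂ F] (x y : E) (z : F) :
    contract x (y ⊗ₜ[ℂ] z) = ⟪x, y⟫_ℂ • z := by
  simp [contract]

/-- The word that starts with `a` letters `0` and goes on with `q`. -/
def prependZeros {N a b m : ℕ} (h : a + b = N) (q : Fin b → Fin (m + 1)) : Fin N → Fin (m + 1) :=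
  fun i => Fin.append (fun _ : Fin a => 0) q (Fin.cast h.symm i)

theorem prependZeros_injective {N a b m : ℕ} (h : a + b = N) :
    Function.Injective (prependZeros (m := m) h) := by
  subst h
  intro p q hpq
  funext i
  simpa [prependZeros] using congrFun hpq (Fin.natAdd a i)

theorem prependZeros_of_lt {N a b m : ℕ} (h : a + b = N) (q : Fin b → Fin (m + 1)) (i : Fin N)
    (hi : i.1 < a) : prependZeros h q i = 0 := by
  subst h
  have : i = Fin.castAdd b ⟨i.1, hi⟩ := rfl
  rw [this, prependZeros, Fin.cast_eq_self, Fin.append_left]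

theorem card_ne_zero_prependZeros {N a b m : ℕ} (h : a + b = N) (q : Fin b → Fin (m + 1)) :
    (Finset.univ.filter fun i => prependZeros h q i ≠ 0).card =
      (Finset.univ.filter fun i => q i ≠ 0).card := by
  subst h
  rw [Finset.card_filter, Finset.card_filter, Fin.sum_univ_add]
  simp [prependZeros]

theorem inner_contract_split {m N a b : ℕ} (h : a + b = N) (e : OrthonormalBasis (Fin (m + 1)) ℂ H)
    {Φ : TensorPow N H} (hΦ : Φ ∈ symSubspace N H) (q : Fin b → Fin (m + 1)) :
    ⟪productBasis b e q, contract (powVec a (e 0)) (split h Φ)⟫_ℂ =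
      ⟪productBasis N e (prependZeros h q), Φ⟫_ℂ := by
  rw [symSubspace_eq_span_powVec] at hΦ
  induction hΦ using Submodule.span_induction with
  | mem x hx =>
    obtain ⟨z, rfl⟩ := hx
    subst h
    rw [split_powVec, contract_tmul, inner_smul_right, inner_powVec, productBasis_apply,
      productBasis_apply, powVec, powVec, inner_prodVec, inner_prodVec, Fin.prod_univ_add]
    simp [prependZeros]
  | zero => simp
  | add x y _ _ hx hy => simp [hx, hy]
  | smul c x _ hx => simp [hx]

theorem contract_split_mem_symSubspace {N a b : ℕ} (h : a + b = N) (x : TensorPow a H)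
    {Φ : TensorPow N H} (hΦ : Φ ∈ symSubspace N H) :
    contract x (split h Φ) ∈ symSubspace b H := by
  rw [symSubspace_eq_span_powVec] at hΦ
  induction hΦ using Submodule.span_induction with
  | mem y hy =>
    obtain ⟨z, rfl⟩ := hy
    rw [split_powVec, contract_tmul]
    exact Submodule.smul_mem _ _ (powVec_mem_symSubspace b z)
  | zero => simp
  | add x y _ _ hx hy => simpa using Submodule.add_mem _ hx hy
  | smul c x _ hx => simpa using Submodule.smul_mem _ c hx

/-- At least `n` letters are 0, and some permutation carries the last `n` positions into their
places. -/
theorem productBasis_mem_restrictedSupport {m k n : ℕ} (e : OrthonormalBasis (Fin (m + 1)) ℂ H)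
    (q : Fin (k + n) → Fin (m + 1)) (hq : (Finset.univ.filter fun i => q i ≠ 0).card ≤ k) :
    productBasis (k + n) e q ∈ restrictedSupport k n (ℂ ∙ e 0) := by
  classical
  have hcard : n ≤ (Finset.univ.filter fun i => q i = 0).card := by
    have := Finset.card_filter_add_card_filter_not (s := (Finset.univ : Finset (Fin (k + n))))
      fun i => q i = 0
    simp only [Finset.card_univ, Fintype.card_fin] at this
    simp only [ne_eq] at hq
    omega
  obtain ⟨T, hT, hTn⟩ := Finset.exists_subset_card_eq hcard
  have hrange : (Finset.univ.map (Fin.natAddEmb k : Fin n ↪ Fin (k + n))).card = T.card := by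
    simp [hTn]
  let σ : Equiv.Perm (Fin (k + n)) := (Finset.equivOfCardEq hrange).extendSubtype
  have hσ (j : Fin n) : q (σ (Fin.natAdd k j)) = 0 := by
    have h1 : σ (Fin.natAdd k j) ∈ T := Equiv.extendSubtype_mem _ _
      (Finset.mem_map.2 ⟨j, Finset.mem_univ _, rfl⟩)
    exact (Finset.mem_filter.1 (hT h1)).2
  refine Submodule.subset_span ⟨σ, fun i => e (q (σ (Fin.castAdd n i))), fun _ => e 0,
    fun _ => Submodule.mem_span_singleton_self _, ?_⟩
  rw [permute_prodVec, productBasis_apply]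
  congr 1
  funext i
  obtain ⟨l, rfl⟩ := σ.surjective i
  rw [Equiv.symm_apply_apply]
  refine Fin.addCases (fun i => ?_) (fun i => ?_) l
  · simp
  · simp [hσ]

/-- The contraction of a symmetric vector with `ν^{⊗k}` is exponentially close to the restricted
symmetric subspace of `ν`. -/
theorem exists_restrictedSym_near {N k n : ℕ} (h : k + (k + n) = N) {ν : H} (hν : ‖ν‖ = 1)
    {Φ : TensorPow N H} (hΦ : Φ ∈ symSubspace N H) :
    ∃ Ψ ∈ restrictedSym k n (ℂ ∙ ν), ‖contract (powVec k ν) (split h Φ) - Ψ‖ ^ 2 ≤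
      Real.exp (-((k : ℝ) * (k + 1) / N)) * ‖Φ‖ ^ 2 := by
  classical
  obtain ⟨m, hm⟩ : ∃ m, Module.finrank ℂ H = m + 1 := by
    have : Nontrivial H := ⟨ν, 0, fun h => by simp [h] at hν⟩
    exact Nat.exists_eq_succ_of_ne_zero Module.finrank_pos.ne'
  obtain ⟨e, rfl⟩ := exists_orthonormalBasis_zero_eq hm hν
  let Θ := contract (powVec k (e 0)) (split h Φ)
  -- Truncation to words with at most `k` nonzero letters; this count is permutation invariant, so
  -- `Ψ` stays symmetric.
  let c (q : Fin (k + n) → Fin (m + 1)) : ℂ :=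
    if (Finset.univ.filter fun i => q i ≠ 0).card ≤ k then ⟪productBasis (k + n) e q, Θ⟫_ℂ else 0
  let Ψ : TensorPow (k + n) H := ∑ q, c q • productBasis (k + n) e q
  have hΨ (q) : ⟪productBasis (k + n) e q, Ψ⟫_ℂ = c q := by
    rw [(productBasis (k + n) e).orthonormal.inner_right_fintype]
  have hnz {M : ℕ} (π : Equiv.Perm (Fin M)) (p : Fin M → Fin (m + 1)) :
      (Finset.univ.filter fun i => (p ∘ π) i ≠ 0).card =
        (Finset.univ.filter fun i => p i ≠ 0).card :=
    Finset.card_equiv π fun i => by simp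
  have hΘ : Θ ∈ symSubspace (k + n) H := contract_split_mem_symSubspace h _ hΦ
  refine ⟨Ψ, ⟨?_, ?_⟩, ?_⟩
  · rw [SetLike.mem_coe, mem_symSubspace_iff e]
    intro π p
    rw [hΨ, hΨ]
    simp only [c, hnz, (mem_symSubspace_iff e Θ).1 hΘ π p]
  · refine Submodule.sum_mem _ fun q _ => ?_
    by_cases hq : (Finset.univ.filter fun i => q i ≠ 0).card ≤ k
    · exact Submodule.smul_mem _ _ (productBasis_mem_restrictedSupport e q hq)
    · simp [c, hq]
  -- The discarded mass of `Φ`: at least `k + 1` nonzero letters, here with a prefix of `k` zeros,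
  -- whence the exponent `k(k+1)/N`.
  · let g (p : Fin N → Fin (m + 1)) : ℝ :=
      if (Finset.univ.filter fun i => p i ≠ 0).card < k + 1 then 0
      else ‖⟪productBasis N e p, Φ⟫_ℂ‖ ^ 2
    have hg (p) : 0 ≤ g p := by
      simp only [g]
      split_ifs <;> positivity
    have htail := sum_prefix_le_exp (0 : Fin (m + 1)) (k + 1) g hg (fun π p => by
      simp only [g, hnz, (mem_symSubspace_iff e Φ).1 hΦ π p]) (fun p hp => if_pos hp) k (by omega)
    have hgΦ : ∑ p, g p ≤ ‖Φ‖ ^ 2 := by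
      rw [← (productBasis N e).sum_sq_norm_inner_right Φ]
      refine Finset.sum_le_sum fun p _ => ?_
      simp only [g]
      split_ifs
      · positivity
      · exact le_rfl
    calc ‖Θ - Ψ‖ ^ 2 = ∑ q, g (prependZeros h q) := by
          rw [← (productBasis (k + n) e).sum_sq_norm_inner_right]
          refine Finset.sum_congr rfl fun q _ => ?_
          rw [inner_sub_right, hΨ]
          simp only [g, c, card_ne_zero_prependZeros, Nat.lt_succ_iff,
            ← inner_contract_split h e hΦ]
          split_ifs <;> simp [Θ]
      _ = ∑ p ∈ Finset.univ.map ⟨prependZeros h, prependZeros_injective h⟩, g p := by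
          rw [Finset.sum_map]; rfl
      _ ≤ ∑ p with ∀ i : Fin N, i.1 < k → p i = 0, g p := by
          refine Finset.sum_le_sum_of_subset_of_nonneg (fun p hp => ?_) fun p _ _ => hg p
          obtain ⟨q, -, rfl⟩ := Finset.mem_map.1 hp
          exact Finset.mem_filter.2 ⟨Finset.mem_univ _, prependZeros_of_lt h q⟩
      _ ≤ Real.exp (-((k : ℝ) * (k + 1 : ℕ) / N)) * ∑ p, g p := htail
      _ ≤ _ := by
          push_cast
          exact mul_le_mul_of_nonneg_left hgΦ (Real.exp_nonneg _)

/-! ### Overlap with a subspace and construction of the isometry -/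

/-- A unit vector that is close to a nontrivial subspace has a large real overlap with some unit
vector of this subspace. -/
theorem exists_unit_overlap {E : Type*} [NormedAddCommGroup E] [InnerProductSpace ℂ E]
    (S : Submodule ℂ E) [S.HasOrthogonalProjection] {φ₀ : E} (hφ₀ : φ₀ ∈ S) (hφ₀' : ‖φ₀‖ = 1)
    {Ω s : E} (hΩ : ‖Ω‖ = 1) (hs : s ∈ S) {ε : ℝ} (hε : ‖Ω - s‖ ^ 2 < ε) :
    ∃ φ ∈ S, ‖φ‖ = 1 ∧ ∃ r : ℝ, ⟪φ, Ω⟫_ℂ = (r : ℂ) ∧ 1 - ε < r := by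
  set P := S.starProjection Ω with hP
  have hPS : P ∈ S := S.starProjection_apply_mem Ω
  have hin (t : E) (ht : t ∈ S) : ⟪t, Ω⟫_ℂ = ⟪t, P⟫_ℂ := by
    have := S.sub_starProjection_mem_orthogonal Ω t ht
    rwa [inner_sub_right, sub_eq_zero] at this
  have horth (t : E) (ht : t ∈ S) : ‖(Ω - P) + t‖ * ‖(Ω - P) + t‖ =
      ‖Ω - P‖ * ‖Ω - P‖ + ‖t‖ * ‖t‖ := by
    refine norm_add_sq_eq_norm_sq_add_norm_sq_of_inner_eq_zero (𝕜 := ℂ) _ _ ?_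
    rw [← inner_conj_symm, S.sub_starProjection_mem_orthogonal Ω t ht, map_zero]
  have h1 := horth P hPS
  rw [sub_add_cancel, hΩ] at h1
  have h2 := horth (P - s) (S.sub_mem hPS hs)
  rw [sub_add_sub_cancel] at h2
  have h3 : 1 - ‖P‖ ^ 2 < ε := by nlinarith [norm_nonneg (P - s)]
  -- If `P = 0` then `ε > 1` and overlap 0 suffices. Otherwise `P / ‖P‖` has overlap `‖P‖ ≥ ‖P‖² > 1
  -- - ε`.
  by_cases hP0 : P = 0
  · refine ⟨φ₀, hφ₀, hφ₀', 0, ?_, ?_⟩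
    · rw [hin φ₀ hφ₀, hP0]; simp
    · rw [hP0] at h3; simp at h3; linarith
  · have hP0' : 0 < ‖P‖ := norm_pos_iff.2 hP0
    refine ⟨((‖P‖⁻¹ : ℝ) : ℂ) • P, S.smul_mem _ hPS, ?_, ‖P‖, ?_, ?_⟩
    · rw [norm_smul]
      simp [hP0'.ne']
    · rw [inner_smul_left, hin P hPS, inner_self_eq_norm_sq_to_K, Complex.conj_ofReal]
      have : (‖P‖ : ℂ) ≠ 0 := by exact_mod_cast hP0'.ne'
      push_cast
      change (‖P‖ : ℂ)⁻¹ * (‖P‖ : ℂ) ^ 2 = _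
      field_simp
    · have : ‖P‖ ≤ 1 := by nlinarith [norm_nonneg (Ω - P)]
      nlinarith

theorem exists_linearIsometry_of_finrank_le {E F : Type*} [NormedAddCommGroup E]
    [InnerProductSpace ℂ E] [FiniteDimensional ℂ E] [NormedAddCommGroup F] [InnerProductSpace ℂ F]
    [FiniteDimensional ℂ F] (h : Module.finrank ℂ E ≤ Module.finrank ℂ F) :
    Nonempty (E →ₗᵢ[ℂ] F) := by
  let b := stdOrthonormalBasis ℂ E
  let c := stdOrthonormalBasis ℂ F
  let f := b.toBasis.constr ℂ fun i => c (Fin.castLE h i)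
  refine ⟨f.isometryOfOrthonormal (v := b.toBasis) (by simp [b.orthonormal]) ?_⟩
  have : f ∘ b.toBasis = c ∘ Fin.castLE h := funext fun i => b.toBasis.constr_basis ℂ _ i
  rw [this]
  exact c.orthonormal.comp _ (Fin.castLE_injective h)

/-- An isometry from a subspace extends to the whole space if the dimension of the codomain
permits. -/
theorem exists_linearIsometry_extension {E F : Type*} [NormedAddCommGroup E]
    [InnerProductSpace ℂ E] [FiniteDimensional ℂ E] [NormedAddCommGroup F] [InnerProductSpace ℂ F]
    [FiniteDimensional ℂ F] (h : Module.finrank ℂ E ≤ Module.finrank ℂ F) (S : Submodule ℂ E)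
    (T : S →ₗᵢ[ℂ] F) : ∃ U : E →ₗᵢ[ℂ] F, ∀ x : S, U x = T x := by
  -- `LinearIsometry.extend` needs a subspace of the codomain, so `S` is first moved into `F` by
  -- `J`.
  obtain ⟨J⟩ := exists_linearIsometry_of_finrank_le h
  let i := Submodule.equivMapOfInjective J.toLinearMap J.injective S
  let T' : S.map J.toLinearMap →ₗᵢ[ℂ] F := ⟨T.toLinearMap ∘ₗ i.symm.toLinearMap, fun x => by
    obtain ⟨y, rfl⟩ := i.surjective x
    simp only [LinearMap.comp_apply, LinearEquiv.coe_coe, LinearEquiv.symm_apply_apply,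
      LinearIsometry.coe_toLinearMap, LinearIsometry.norm_map]
    exact (J.norm_map y).symm⟩
  refine ⟨T'.extend.comp J, fun x => ?_⟩
  have h1 : T'.extend (i x : F) = T' (i x) := T'.extend_apply (i x)
  have h2 : T' (i x) = T x := congrArg T (i.symm_apply_apply x)
  exact h1.trans h2

/-- The frame operator of a tight frame of powers extends to an isometry of the tensor power. -/
theorem exists_frame_isometry {k : ℕ} {V : Finset H}
    (hcard : Module.finrank ℂ (TensorPow k H) ≤ V.card) {w : H → ℝ} (hw0 : ∀ ν, 0 ≤ w ν)
    (hw : ∀ x ∈ symSubspace k H, ∑ ν ∈ V, w ν * ‖⟪powVec k ν, x⟫_ℂ‖ ^ 2 = ‖x‖ ^ 2) :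
    ∃ U : TensorPow k H →ₗᵢ[ℂ] EuclideanSpace ℂ V, ∀ x ∈ symSubspace k H,
      U x = ∑ ν : V, ((√(w ν) : ℂ) * ⟪powVec k (ν : H), x⟫_ℂ) • EuclideanSpace.basisFun V ℂ ν := by
  let L : symSubspace k H →ₗ[ℂ] EuclideanSpace ℂ V :=
    ∑ ν : V, (((√(w ν) : ℂ) • innerₛₗ ℂ (powVec k (ν : H))).smulRight
      (EuclideanSpace.basisFun V ℂ ν)) ∘ₗ (symSubspace k H).subtype
  have hL (x : symSubspace k H) : L x = ∑ ν : V, ((√(w ν) : ℂ) *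
      ⟪powVec k (ν : H), (x : TensorPow k H)⟫_ℂ) • EuclideanSpace.basisFun V ℂ ν := by
    simp [L]
  have hnorm (x : symSubspace k H) : ‖L x‖ = ‖x‖ := by
    have h1 : ‖L x‖ ^ 2 = ‖x‖ ^ 2 := by
      rw [← (EuclideanSpace.basisFun V ℂ).sum_sq_norm_inner_right, Submodule.coe_norm,
        ← hw x x.2, ← Finset.sum_coe_sort V]
      refine Finset.sum_congr rfl fun ν _ => ?_
      rw [hL, (EuclideanSpace.basisFun V ℂ).orthonormal.inner_right_fintype, norm_mul, mul_pow]
      simp [Real.sq_sqrt (hw0 ν)]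
    exact (sq_eq_sq₀ (norm_nonneg _) (norm_nonneg _)).1 h1
  obtain ⟨U, hU⟩ := exists_linearIsometry_extension (by simpa using hcard) (symSubspace k H)
    (⟨L, hnorm⟩ : symSubspace k H →ₗᵢ[ℂ] EuclideanSpace ℂ V)
  exact ⟨U, fun x hx => (hU ⟨x, hx⟩).trans (hL ⟨x, hx⟩)⟩

/-- `U` is explicit only on `Sym^k(H)`. This is enough, because `Φ` is a combination of powers,
whose first factors are again powers. -/
theorem rTensor_split_eq {N k b : ℕ} (h : k + b = N) {V : Finset H} {w : H → ℝ}
    {U : TensorPow k H →ₗᵢ[ℂ] EuclideanSpace ℂ V} (hU : ∀ x ∈ symSubspace k H,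
      U x = ∑ ν : V, ((√(w ν) : ℂ) * ⟪powVec k (ν : H), x⟫_ℂ) • EuclideanSpace.basisFun V ℂ ν)
    {Φ : TensorPow N H} (hΦ : Φ ∈ symSubspace N H) :
    U.rTensor (TensorPow b H) (split h Φ) = ∑ ν : V, EuclideanSpace.basisFun V ℂ ν ⊗ₜ[ℂ]
      ((√(w ν) : ℂ) • contract (powVec k (ν : H)) (split h Φ)) := by
  rw [symSubspace_eq_span_powVec] at hΦ
  induction hΦ using Submodule.span_induction with
  | mem x hx =>
    obtain ⟨z, rfl⟩ := hx
    rw [split_powVec, LinearIsometry.rTensor_apply, LinearMap.rTensor_tmul,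
      LinearIsometry.coe_toLinearMap, hU _ (powVec_mem_symSubspace k z), TensorProduct.sum_tmul]
    refine Finset.sum_congr rfl fun ν _ => ?_
    rw [contract_tmul, TensorProduct.smul_tmul, smul_smul]
  | zero => simp
  | add x y _ _ hx hy => simp only [map_add, hx, hy, smul_add, TensorProduct.tmul_add,
      Finset.sum_add_distrib]
  | smul c x _ hx => simp only [map_smul, hx, Finset.smul_sum, TensorProduct.tmul_smul,
      smul_comm c]

theorem inner_split {N a b : ℕ} (h : a + b = N) {Φ Ψ : TensorPow N H}
    (hΦ : Φ ∈ symSubspace N H) (hΨ : Ψ ∈ symSubspace N H) :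
    ⟪split h Φ, split h Ψ⟫_ℂ = ⟪Φ, Ψ⟫_ℂ := by
  rw [symSubspace_eq_span_powVec] at hΦ hΨ
  induction hΦ, hΨ using Submodule.span_induction₂ with
  | mem_mem x y hx hy =>
    obtain ⟨x, rfl⟩ := hx
    obtain ⟨y, rfl⟩ := hy
    rw [split_powVec, split_powVec, TensorProduct.inner_tmul, inner_powVec, inner_powVec,
      inner_powVec, ← pow_add, h]
  | zero_left => simp
  | zero_right => simp
  | add_left _ _ _ _ _ _ h1 h2 => simp [inner_add_left, h1, h2]
  | add_right _ _ _ _ _ _ h1 h2 => simp [inner_add_right, h1, h2]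
  | smul_left r x y _ _ ih =>
    rw [map_smul, inner_smul_left]
    exact (inner_smul_left (𝕜 := ℂ) (split h x) (split h y) r).trans (congrArg _ ih)
  | smul_right r x y _ _ ih =>
    rw [map_smul, inner_smul_right]
    exact (inner_smul_right (𝕜 := ℂ) (split h x) (split h y) r).trans (congrArg _ ih)

theorem norm_split {N a b : ℕ} (h : a + b = N) {Φ : TensorPow N H} (hΦ : Φ ∈ symSubspace N H) :
    ‖split h Φ‖ = ‖Φ‖ := by
  rw [norm_eq_sqrt_re_inner (𝕜 := ℂ), norm_eq_sqrt_re_inner (𝕜 := ℂ), inner_split h hΦ hΦ]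

theorem norm_sum_basisFun_tmul_sq {ι F : Type*} [Fintype ι] [NormedAddCommGroup F]
    [InnerProductSpace ℂ F] (ψ : ι → F) :
    ‖∑ i, EuclideanSpace.basisFun ι ℂ i ⊗ₜ[ℂ] ψ i‖ ^ 2 = ∑ i, ‖ψ i‖ ^ 2 := by
  classical
  have h : ((‖∑ i, EuclideanSpace.basisFun ι ℂ i ⊗ₜ[ℂ] ψ i‖ ^ 2 : ℝ) : ℂ) =
      ((∑ i, ‖ψ i‖ ^ 2 : ℝ) : ℂ) := by
    push_cast
    refine (inner_self_eq_norm_sq_to_K (𝕜 := ℂ)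
      (∑ i, EuclideanSpace.basisFun ι ℂ i ⊗ₜ[ℂ] ψ i)).symm.trans ?_
    rw [sum_inner]
    refine Finset.sum_congr rfl fun i _ => ?_
    simp_rw [inner_sum, TensorProduct.inner_tmul,
      orthonormal_iff_ite.1 (EuclideanSpace.basisFun ι ℂ).orthonormal]
    simp
  exact_mod_cast h

/-- The subspace of all `∑ f_i ⊗ ψ_i` with `ψ_i` in a given subspace `R i`. -/
noncomputable def directSumSubspace {ι F : Type*} [Fintype ι] [AddCommGroup F] [Module ℂ F]
    (R : ι → Submodule ℂ F) : Submodule ℂ (EuclideanSpace ℂ ι ⊗[ℂ] F) where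
  carrier := {t | ∃ ψ : ι → F, (∀ i, ψ i ∈ R i) ∧
    t = ∑ i, EuclideanSpace.basisFun ι ℂ i ⊗ₜ[ℂ] ψ i}
  add_mem' := by
    rintro _ _ ⟨ψ, hψ, rfl⟩ ⟨φ, hφ, rfl⟩
    exact ⟨ψ + φ, fun i => (R i).add_mem (hψ i) (hφ i), by
      simp [TensorProduct.tmul_add, Finset.sum_add_distrib]⟩
  zero_mem' := ⟨0, fun i => (R i).zero_mem, by simp⟩
  smul_mem' := by
    rintro c _ ⟨ψ, hψ, rfl⟩
    exact ⟨c • ψ, fun i => (R i).smul_mem c (hψ i), by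
      simp [TensorProduct.tmul_smul, Finset.smul_sum]⟩

/-- Supplies the unit vector needed when the projection in `exists_unit_overlap` vanishes. -/
theorem powVec_mem_restrictedSym {H : Type*} [AddCommGroup H] [Module ℂ H] (k n : ℕ) (ν : H) :
    powVec (k + n) ν ∈ restrictedSym k n (ℂ ∙ ν) := by
  have h : Fin.append (fun _ : Fin k => ν) (fun _ : Fin n => ν) = fun _ => ν :=
    funext fun i => Fin.addCases (fun i => Fin.append_left _ _ i)
      (fun i => Fin.append_right _ _ i) i
  refine ⟨powVec_mem_symSubspace _ ν, Submodule.subset_span ⟨1, fun _ => ν, fun _ => ν,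
    fun _ => Submodule.mem_span_singleton_self ν, ?_⟩⟩
  rw [h, permute_prodVec, powVec]

end DeFinetti

open DeFinetti

/-! ### Assembly -/

theorem mainTheorem3 {H : Type*} [NormedAddCommGroup H] [InnerProductSpace ℂ H]
    [FiniteDimensional ℂ H] (d k n : ℕ) (hd : Module.finrank ℂ H = d) (hk : 2 ≤ k) :
    ∃ V : Finset H, (∀ ν ∈ V, ‖ν‖ = 1) ∧
      ∃ U : DeFinetti.TensorPow k H →ₗᵢ[ℂ] EuclideanSpace ℂ V,
        ∀ Φ ∈ DeFinetti.symSubspace (2 * k + n) H, ‖Φ‖ = 1 →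
          ∃ Φhat : EuclideanSpace ℂ V ⊗[ℂ] DeFinetti.TensorPow (k + n) H, ‖Φhat‖ = 1 ∧
          ∃ Φν : V → DeFinetti.TensorPow (k + n) H,
            (∀ ν : V, Φν ν ∈ DeFinetti.restrictedSym k n (ℂ ∙ (ν : H))) ∧
            Φhat = ((1 / √(V.card : ℝ) : ℝ) : ℂ) •
              ∑ ν : V, EuclideanSpace.basisFun V ℂ ν ⊗ₜ[ℂ] Φν ν ∧
            ∃ r : ℝ, ⟪Φhat, U.rTensor (DeFinetti.TensorPow (k + n) H)
                (DeFinetti.split (by omega : k + (k + n) = 2 * k + n) Φ)⟫_ℂ = (r : ℂ) ∧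
              1 - (k : ℝ) ^ d * Real.exp (-((k : ℝ) * (k + 1) / (2 * k + n))) < r := by
  have hN : k + (k + n) = 2 * k + n := by omega
  -- For `d = 0` there is no unit vector `Φ`, since `2k + n > 0`.
  rcases Nat.eq_zero_or_pos d with rfl | hd0
  · have hH : Subsingleton H := Module.finrank_zero_iff.1 hd
    have hT {N : ℕ} (hN : 0 < N) (Φ : TensorPow N H) : Φ = 0 := by
      have : IsEmpty (Fin N → Fin (Module.finrank ℂ H)) := by
        rw [hd]
        exact ⟨fun p => (p ⟨0, hN⟩).elim0⟩
      exact ext_inner_productBasis (stdOrthonormalBasis ℂ H) isEmptyElim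
    refine ⟨∅, by simp, ⟨0, fun x => by simp [hT (by omega : 0 < k) x]⟩, fun Φ _ hΦ => ?_⟩
    rw [hT (by omega) Φ, norm_zero] at hΦ
    exact (zero_ne_one hΦ).elim
  · have : Nontrivial H := Module.nontrivial_of_finrank_pos (R := ℂ) (hd ▸ hd0)
    obtain ⟨ν₀, hν₀⟩ := exists_norm_eq H zero_le_one
    obtain ⟨V, hV, hcard, w, hw0, hw⟩ :=
      exists_finset_frame k (Module.finrank ℂ (TensorPow k H) + 1) hν₀
    obtain ⟨U, hU⟩ := exists_frame_isometry ((Nat.le_succ _).trans hcard) hw0 hw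
    refine ⟨V, hV, U, fun Φ hΦ hΦ1 => ?_⟩
    obtain ⟨ν₁, hν₁⟩ : V.Nonempty := Finset.card_pos.1 (by omega)
    have hVpos : 0 < √(V.card : ℝ) := Real.sqrt_pos.2 (by exact_mod_cast Finset.card_pos.2 ⟨_, hν₁⟩)
    choose Ψ hΨ hΨ' using fun ν : V => exists_restrictedSym_near hN (hV ν ν.2) hΦ
    let S := directSumSubspace fun ν : V => restrictedSym k n (ℂ ∙ (ν : H))
    let s : EuclideanSpace ℂ V ⊗[ℂ] TensorPow (k + n) H :=
      ∑ ν : V, EuclideanSpace.basisFun V ℂ ν ⊗ₜ[ℂ] ((√(w ν) : ℂ) • Ψ ν)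
    have hs : s ∈ S := ⟨_, fun ν => Submodule.smul_mem _ _ (hΨ ν), rfl⟩
    have hφ₀ : EuclideanSpace.basisFun V ℂ ⟨ν₁, hν₁⟩ ⊗ₜ[ℂ] powVec (k + n) ν₁ ∈ S := by
      classical
      refine ⟨Pi.single ⟨ν₁, hν₁⟩ (powVec (k + n) ν₁), fun ν => ?_, ?_⟩
      · by_cases h : ν = ⟨ν₁, hν₁⟩
        · subst h
          rw [Pi.single_eq_same]
          exact powVec_mem_restrictedSym k n ν₁
        · rw [Pi.single_eq_of_ne h]
          exact Submodule.zero_mem _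
      · rw [Finset.sum_eq_single ⟨ν₁, hν₁⟩ (fun ν _ h => by simp [Pi.single_eq_of_ne h]) (by simp),
          Pi.single_eq_same]
    have hφ₀' : ‖EuclideanSpace.basisFun V ℂ ⟨ν₁, hν₁⟩ ⊗ₜ[ℂ] powVec (k + n) ν₁‖ = 1 := by
      rw [TensorProduct.norm_tmul, norm_powVec, hV _ hν₁]
      simp
    have hclose : ‖U.rTensor (TensorPow (k + n) H) (split hN Φ) - s‖ ^ 2 <
        (k : ℝ) ^ d * Real.exp (-((k : ℝ) * (k + 1) / (2 * k + n))) := by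
      rw [rTensor_split_eq hN hU hΦ, ← Finset.sum_sub_distrib]
      simp_rw [← TensorProduct.tmul_sub, ← smul_sub]
      rw [norm_sum_basisFun_tmul_sq]
      have hdim : ∑ ν : V, w ν < (k : ℝ) ^ d := by
        rw [Finset.sum_coe_sort V w, sum_weights_eq_finrank hV hw]
        have h := finrank_symSubspace_le (H := H) k
        rw [hd] at h
        exact_mod_cast h.trans_lt (multichoose_lt_pow hd0 hk)
      refine lt_of_le_of_lt ?_ (mul_lt_mul_of_pos_right hdim (Real.exp_pos _))
      rw [Finset.sum_mul]
      refine Finset.sum_le_sum fun ν _ => ?_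
      rw [norm_smul, mul_pow, Complex.norm_real, Real.norm_eq_abs, sq_abs, Real.sq_sqrt (hw0 ν)]
      refine mul_le_mul_of_nonneg_left ((hΨ' ν).trans_eq ?_) (hw0 ν)
      rw [hΦ1]
      push_cast
      ring
    obtain ⟨φ, ⟨ψ, hψ, hφψ⟩, hφ1, r, hr, hr'⟩ := exists_unit_overlap S hφ₀ hφ₀'
      (by rw [LinearIsometry.norm_map, norm_split hN hΦ, hΦ1]) hs hclose
    refine ⟨φ, hφ1, fun ν => ((√(V.card : ℝ) : ℝ) : ℂ) • ψ ν,
      fun ν => Submodule.smul_mem _ _ (hψ ν), ?_, r, hr, hr'⟩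
    simp_rw [TensorProduct.tmul_smul]
    rw [← Finset.smul_sum, smul_smul, ← Complex.ofReal_mul, one_div, inv_mul_cancel₀ hVpos.ne',
      Complex.ofReal_one, one_smul, hφψ]
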